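/- Let $1\le t\le k\le \frac{n-1}{2}$ be integers, let $\mathbf a=(a_1,\dots,a_n)=(1,\dots,1,t)$, and put $$S(\mathbf a,k)=\Big\{(v_1,\dots,v_n)\in\{0,1\}^n : \sum_{i=1}^n a_iv_i=k\Big\}\subseteq\mathbb Q^n .$$ Let $I(S(\mathbf a,k))\subseteq\mathbb Q[x_1,\dots,x_n]$ be the ideal of all polynomials vanishing on $S(\mathbf a,k)$. Order monomials lexicographically with $x_1\succ x_2\succ\cdots\succ x_n$, that is, $x_1^{i_1}\cdots x_n^{i_n}\prec x_1^{j_1}\cdots x_n^{j_n}$ if and only if the two monomials differ and $i_r<j_r$ for the smallest index $r$ with $i_r\ne j_r$. A monomial is a *lex standard monomial* of an ideal $I$ if it is not the leading (that is, $\prec$-largest) monomial of any nonzero $f\in I$; the set of these is denoted by $\mathrm{sm}(I)$. For integers $d,m\ge 0$ let $\mathcal M_{d,m}$ be the set of monomials $\prod_{i=1}^{j}x_{s_i}$ with $0\le j\le d$, $1\le s_1<s_2<\cdots<s_j\le m$ and $s_i\ge 2i$ for every $1\le i\le j$. Then $$\mathrm{sm}\big(I(S(\mathbf a,k))\big)=\mathcal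 M_{k,n-1}\cup\{\mathbf m\,x_n:\ \mathbf m\in\mathcal M_{k-t,n-1}\}.$$ -/

import Mathlib

open MvPolynomial

/-- The points of `{0,1}ⁿ ⊆ ℚⁿ` on which `∑ aᵢ vᵢ = k`; this is the set `S(a, k)`. -/
def linearSperner {n : ℕ} (a : Fin n → ℕ) (k : ℕ) : Set (Fin n → ℚ) :=
  {v | (∀ i, v i = 0 ∨ v i = 1) ∧ ∑ i, (a i : ℚ) * v i = (k : ℚ)}

/-- The standard monomials of an ideal `I` for a monomial order: the monomials (given by their
exponent vectors) that are not the leading monomial of any nonzero element of `I`. -/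
def standardMonomials {σ F : Type*} [Field F] (ord : MonomialOrder σ)
    (I : Ideal (MvPolynomial σ F)) : Set (σ →₀ ℕ) :=
  {w | ¬ ∃ f ∈ I, f ≠ 0 ∧ ord.degree f = w}

/-- The lexicographic standard monomials of `I`, where `x₁ ≻ x₂ ≻ ⋯ ≻ xₙ`
(the variable `xⱼ` is `X i` with `(i : ℕ) = j - 1`). -/
noncomputable def lexStandardMonomials {n : ℕ} {F : Type*} [Field F]
    (I : Ideal (MvPolynomial (Fin n) F)) : Set (Fin n →₀ ℕ) :=
  standardMonomials MonomialOrder.lex I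

/-- The exponent vector of the square-free monomial `x_G = ∏_{j ∈ G} xⱼ`. -/
noncomputable def squarefreeMonomial {n : ℕ} (G : Finset (Fin n)) : Fin n →₀ ℕ :=
  ∑ j ∈ G, Finsupp.single j 1

/-- `M_{d,n}`, the ballot monomials of degree at most `d` in `x₁, …, xₙ`: the monomials `x_G` with
`G = {s₁ < ⋯ < s_j}`, `j ≤ d` and `sᵢ ≥ 2 i` for `1 ≤ i ≤ j`. Positions `i` and elements `sᵢ`
are both counted from `0` in the code, hence the two `+ 1`. -/
def ballotMonomials (d n : ℕ) : Set (Fin n →₀ ℕ) :=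
  {w | ∃ G : Finset (Fin n), G.card ≤ d ∧
    (∀ i : Fin G.card, 2 * ((i : ℕ) + 1) ≤ (G.orderEmbOfFin rfl i : ℕ) + 1) ∧
    w = squarefreeMonomial G}

/-- A monomial in the first `m` variables, regarded as a monomial in `m + 1` variables. -/
noncomputable def liftMonomial {m : ℕ} (u : Fin m →₀ ℕ) : Fin (m + 1) →₀ ℕ :=
  u.mapDomain Fin.castSucc

/-!
The set `S(a, k)` is `V₀ × {0} ∪ V₁ × {1}`, where `V₀` and `V₁` are the slices of the cube
`{0,1}^m` of weights `k` and `k - t`. Write `y` for the last variable. Since `y` is the least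
significant variable, the standard monomials of such a union are determined by those of the two
fibres: for a monomial `u` in the other variables,

* `u` is standard for the union iff it is standard for `V₀` or for `V₁`;
* `u y` is standard iff `u` is standard for both;
* `u y^j` with `j ≥ 2` never is, because `y^2 = y` on the union.

(`isLexLeading_snocMonomial_zero`, `isLexLeading_snocMonomial_one` and
`isLexLeading_snocMonomial_of_two_le`, phrased for leading monomials.)

A slice of the cube is itself such a union of two slices of a smaller cube, so the same rule
gives by induction that the standard monomials of the slice of weight `d` in `{0,1}^m` are the
ballot monomials of degree at most `min d (m - d)` (`not_isLexLeading_cubeSlice_iff`). For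
`2 d ≤ m` these form `M_{d,m}`. One more use of the rule, with `M_{k-t,m} ⊆ M_{k,m}`, yields the
theorem.
-/

/-! ### Splitting off the last variable -/

/-- `w` is the leading exponent, in the lexicographic order, of some polynomial vanishing on `V`. -/
def IsLexLeading {n : ℕ} {F : Type*} [Field F] (V : Set (Fin n → F)) (w : Fin n →₀ ℕ) : Prop :=
  ∃ f : MvPolynomial (Fin n) F, (∀ v ∈ V, eval v f = 0) ∧ coeff w f ≠ 0 ∧
    ∀ w', toLex w < toLex w' → coeff w' f = 0

theorem mem_lexStandardMonomials_vanishingIdeal {n : ℕ} {F : Type*} [Field F]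
    (V : Set (Fin n → F)) (w : Fin n →₀ ℕ) :
    w ∈ lexStandardMonomials (vanishingIdeal F V) ↔ ¬ IsLexLeading V w := by
  refine not_congr ⟨?_, ?_⟩
  · rintro ⟨f, hf, hf0, rfl⟩
    refine ⟨f, fun v hv => by simpa [aeval_eq_eval] using mem_vanishingIdeal_iff.1 hf v hv,
      MonomialOrder.coeff_degree_ne_zero_iff.2 hf0, fun w' hw' => ?_⟩
    exact MonomialOrder.coeff_eq_zero_of_lt (MonomialOrder.lex_lt_iff.2 hw')
  · rintro ⟨f, hf, hw, hlt⟩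
    have hf0 : f ≠ 0 := by
      rintro rfl
      simp at hw
    refine ⟨f, mem_vanishingIdeal_iff.2 fun v hv => by simpa [aeval_eq_eval] using hf v hv,
      hf0, ?_⟩
    apply MonomialOrder.lex.toSyn.injective
    apply le_antisymm
    · refine not_lt.1 fun h => ?_
      exact MonomialOrder.coeff_degree_ne_zero_iff.2 hf0 (hlt _ (MonomialOrder.lex_lt_iff.1 h))
    · exact MonomialOrder.le_degree (mem_support_iff.2 hw)

@[simp]
theorem liftMonomial_castSucc {m : ℕ} (u : Fin m →₀ ℕ) (i : Fin m) :
    liftMonomial u i.castSucc = u i :=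
  Finsupp.mapDomain_apply (Fin.castSucc_injective m) u i

@[simp]
theorem liftMonomial_last {m : ℕ} (u : Fin m →₀ ℕ) : liftMonomial u (Fin.last m) = 0 :=
  Finsupp.mapDomain_of_notMem_range _ _ (by simp)

/-- The exponent vector of `x^u * x_{m+1}^j`, where `u` involves only the first `m` variables. -/
noncomputable def snocMonomial {m : ℕ} (u : Fin m →₀ ℕ) (j : ℕ) : Fin (m + 1) →₀ ℕ :=
  liftMonomial u + Finsupp.single (Fin.last m) j

@[simp]
theorem snocMonomial_castSucc {m : ℕ} (u : Fin m →₀ ℕ) (j : ℕ) (i : Fin m) :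
    snocMonomial u j i.castSucc = u i := by
  simp [snocMonomial]

@[simp]
theorem snocMonomial_last {m : ℕ} (u : Fin m →₀ ℕ) (j : ℕ) :
    snocMonomial u j (Fin.last m) = j := by
  simp [snocMonomial]

theorem snocMonomial_zero {m : ℕ} (u : Fin m →₀ ℕ) : snocMonomial u 0 = liftMonomial u := by
  simp [snocMonomial]

theorem exists_eq_snocMonomial {m : ℕ} (w : Fin (m + 1) →₀ ℕ) : ∃ u j, w = snocMonomial u j := by
  refine ⟨Finsupp.equivFunOnFinite.symm fun i => w i.castSucc, w (Fin.last m), ?_⟩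
  ext i
  refine Fin.lastCases ?_ (fun i => ?_) i <;> simp

theorem snocMonomial_inj {m : ℕ} {u u' : Fin m →₀ ℕ} {j j' : ℕ} :
    snocMonomial u j = snocMonomial u' j' ↔ u = u' ∧ j = j' := by
  refine ⟨fun h => ⟨?_, ?_⟩, fun h => by rw [h.1, h.2]⟩
  · ext i
    simpa using DFunLike.congr_fun h i.castSucc
  · simpa using DFunLike.congr_fun h (Fin.last m)

/-- The last variable is the least significant one. -/
theorem toLex_snocMonomial_lt {m : ℕ} {u u' : Fin m →₀ ℕ} {j j' : ℕ} :
    toLex (snocMonomial u j) < toLex (snocMonomial u' j') ↔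
      toLex u < toLex u' ∨ u = u' ∧ j < j' := by
  simp only [Finsupp.Lex.lt_iff, ofLex_toLex]
  constructor
  · rintro ⟨i, hi, hlt⟩
    induction i using Fin.lastCases with
    | last =>
      refine Or.inr ⟨?_, by simpa using hlt⟩
      ext i
      simpa using hi i.castSucc (Fin.castSucc_lt_last i)
    | cast i =>
      refine Or.inl ⟨i, fun l hl => ?_, by simpa using hlt⟩
      simpa using hi l.castSucc (Fin.castSucc_lt_castSucc_iff.2 hl)
  · rintro (⟨i, hi, hlt⟩ | ⟨rfl, hlt⟩)
    · refine ⟨i.castSucc, fun l => ?_, by simpa using hlt⟩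
      induction l using Fin.lastCases with
      | last => exact fun h => absurd h (Fin.castSucc_lt_last i).not_gt
      | cast l => exact fun h => by simpa using hi l (Fin.castSucc_lt_castSucc_iff.1 h)
    · refine ⟨Fin.last m, fun l => ?_, by simpa using hlt⟩
      induction l using Fin.lastCases with
      | last => exact fun h => absurd h (lt_irrefl _)
      | cast l => simp

/-- Polynomials in `m + 1` variables as polynomials in the last one, with coefficients in the
first `m`. -/
noncomputable def lastVarEquiv (F : Type*) [Field F] (m : ℕ) :
    MvPolynomial (Fin (m + 1)) F ≃ₐ[F] Polynomial (MvPolynomial (Fin m) F) :=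
  (renameEquiv F finSuccEquivLast).trans (optionEquivLeft F (Fin m))

theorem coeff_coeff_lastVarEquiv {F : Type*} [Field F] {m : ℕ}
    (f : MvPolynomial (Fin (m + 1)) F) (u : Fin m →₀ ℕ) (j : ℕ) :
    coeff u ((lastVarEquiv F m f).coeff j) = coeff (snocMonomial u j) f := by
  have h := optionEquivLeft_coeff_some_coeff_none F (Fin m)
    ((snocMonomial u j).mapDomain finSuccEquivLast) (rename finSuccEquivLast f)
  rw [coeff_rename_mapDomain _ finSuccEquivLast.injective] at h
  rw [← h]
  have hnone : (snocMonomial u j).mapDomain finSuccEquivLast none = j := by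
    rw [← finSuccEquivLast_last, Finsupp.mapDomain_apply finSuccEquivLast.injective]
    simp
  have hsome : ((snocMonomial u j).mapDomain finSuccEquivLast).some = u := by
    ext i
    rw [Finsupp.some_apply, ← finSuccEquivLast_castSucc,
      Finsupp.mapDomain_apply finSuccEquivLast.injective]
    simp
  rw [hnone, hsome]
  rfl

theorem eval_eq_eval_lastVarEquiv {F : Type*} [Field F] {m : ℕ}
    (f : MvPolynomial (Fin (m + 1)) F) (v : Fin (m + 1) → F) :
    eval v f =
      eval (Fin.init v) ((lastVarEquiv F m f).eval (C (v (Fin.last m)))) := by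
  have h := optionEquivLeft_elim_eval F (Fin m) (Fin.init v) (v (Fin.last m))
    (rename finSuccEquivLast f)
  rw [eval_rename] at h
  have hv : (fun o : Option (Fin m) => o.elim (v (Fin.last m)) (Fin.init v)) ∘ finSuccEquivLast
      = v := by
    funext i
    refine Fin.lastCases ?_ (fun i => ?_) i <;> simp [Fin.init]
  rw [hv] at h
  rw [h, Polynomial.eval_map, ← Polynomial.eval₂_at_apply]
  simp [lastVarEquiv]

/-- The set `V₀ × {0} ∪ V₁ × {1}`, the last coordinate being the one that is `0` or `1`. -/
def fiberUnion {m : ℕ} {F : Type*} [Field F] (V₀ V₁ : Set (Fin m → F)) : Set (Fin (m + 1) → F) :=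
  {v | (v (Fin.last m) = 0 ∧ Fin.init v ∈ V₀) ∨ (v (Fin.last m) = 1 ∧ Fin.init v ∈ V₁)}

/-- Exhibiting a leading exponent of the ideal of `V₀ × {0} ∪ V₁ × {1}` amounts to exhibiting a
polynomial in the last variable with coefficients in the others. -/
theorem isLexLeading_fiberUnion_iff {m : ℕ} {F : Type*} [Field F] {V₀ V₁ : Set (Fin m → F)}
    {u : Fin m →₀ ℕ} {j : ℕ} :
    IsLexLeading (fiberUnion V₀ V₁) (snocMonomial u j) ↔
      ∃ p : Polynomial (MvPolynomial (Fin m) F),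
        (∀ v ∈ V₀, eval v (p.eval 0) = 0) ∧ (∀ v ∈ V₁, eval v (p.eval 1) = 0) ∧
        coeff u (p.coeff j) ≠ 0 ∧ (∀ i > j, coeff u (p.coeff i) = 0) ∧
        ∀ u', toLex u < toLex u' → ∀ i, coeff u' (p.coeff i) = 0 := by
  constructor
  · rintro ⟨f, hf, hu, hlt⟩
    refine ⟨lastVarEquiv F m f, fun v hv => ?_, fun v hv => ?_, ?_, fun i hi => ?_,
      fun u' hu' i => ?_⟩
    · have h := hf (Fin.snoc v 0) (Or.inl ⟨by simp, by simpa using hv⟩)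
      rw [eval_eq_eval_lastVarEquiv] at h
      simpa using h
    · have h := hf (Fin.snoc v 1) (Or.inr ⟨by simp, by simpa using hv⟩)
      rw [eval_eq_eval_lastVarEquiv] at h
      simpa using h
    · rwa [coeff_coeff_lastVarEquiv]
    · rw [coeff_coeff_lastVarEquiv]
      exact hlt _ (toLex_snocMonomial_lt.2 (Or.inr ⟨rfl, hi⟩))
    · rw [coeff_coeff_lastVarEquiv]
      exact hlt _ (toLex_snocMonomial_lt.2 (Or.inl hu'))
  · rintro ⟨p, h₀, h₁, hu, hlast, hlt⟩
    refine ⟨(lastVarEquiv F m).symm p, ?_, ?_, fun w' hw' => ?_⟩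
    · rintro v (⟨hv, hv'⟩ | ⟨hv, hv'⟩)
      · rw [eval_eq_eval_lastVarEquiv]
        simpa [hv] using h₀ _ hv'
      · rw [eval_eq_eval_lastVarEquiv]
        simpa [hv] using h₁ _ hv'
    · rw [← coeff_coeff_lastVarEquiv]
      simpa using hu
    · obtain ⟨u', i, rfl⟩ := exists_eq_snocMonomial w'
      rw [← coeff_coeff_lastVarEquiv, AlgEquiv.apply_symm_apply]
      rcases toLex_snocMonomial_lt.1 hw' with h | ⟨rfl, h⟩
      · exact hlt _ h i
      · exact hlast _ h

theorem coeff_eval_one {F : Type*} [Field F] {m : ℕ} (p : Polynomial (MvPolynomial (Fin m) F))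
    (u : Fin m →₀ ℕ) :
    coeff u (p.eval 1) = ∑ i ∈ Finset.range (p.natDegree + 1), coeff u (p.coeff i) := by
  simp [Polynomial.eval_eq_sum_range, coeff_sum]

/-- If `f₀` and `f₁` vanish on the two fibres and both have leading monomial `x^u`, then
`(1 - y) f₀ + y f₁`, where `y` is the last variable, has leading monomial `x^u` once `f₀` and `f₁`
are made monic. Conversely one substitutes `0` and `1` for `y`. -/
theorem isLexLeading_snocMonomial_zero {m : ℕ} {F : Type*} [Field F] {V₀ V₁ : Set (Fin m → F)}
    {u : Fin m →₀ ℕ} :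
    IsLexLeading (fiberUnion V₀ V₁) (snocMonomial u 0) ↔
      IsLexLeading V₀ u ∧ IsLexLeading V₁ u := by
  rw [isLexLeading_fiberUnion_iff]
  constructor
  · rintro ⟨p, h₀, h₁, hu, hlast, hlt⟩
    refine ⟨⟨p.eval 0, h₀, ?_, fun u' hu' => ?_⟩, ⟨p.eval 1, h₁, ?_, fun u' hu' => ?_⟩⟩
    · rwa [← Polynomial.coeff_zero_eq_eval_zero]
    · rw [← Polynomial.coeff_zero_eq_eval_zero, hlt u' hu']
    · rwa [coeff_eval_one, Finset.sum_range_succ', Finset.sum_eq_zero, zero_add]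
      exact fun i _ => hlast _ i.succ_pos
    · rw [coeff_eval_one]
      exact Finset.sum_eq_zero fun i _ => hlt u' hu' i
  · rintro ⟨⟨f, hf, hfu, hf'⟩, ⟨g, hg, hgu, hg'⟩⟩
    refine ⟨.C (C (coeff u f)⁻¹ * f) +
      .C (C (coeff u g)⁻¹ * g - C (coeff u f)⁻¹ * f) * .X, ?_, ?_, ?_, ?_, ?_⟩
    · intro v hv
      simp [hf v hv]
    · intro v hv
      simp [hg v hv]
    · simp [hfu]
    · rintro (_ | _ | i) hi
      · exact absurd hi (lt_irrefl _)
      · simp [Polynomial.coeff_C, hfu, hgu]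
      · simp
    · rintro u' hu' (_ | _ | i)
      · simp [hf' u' hu']
      · simp [Polynomial.coeff_C, hf' u' hu', hg' u' hu']
      · simp

/-- If `p = c₁ x^u y + c₀ x^u + ⋯` vanishes on `V₀ × {0} ∪ V₁ × {1}`, then `x^u` has coefficient
`c₀` at `y = 0` and `c₀ + c₁` at `y = 1`, and these are not both zero. Conversely one multiplies
a polynomial that vanishes on one fibre by `y - 1` or by `y`. -/
theorem isLexLeading_snocMonomial_one {m : ℕ} {F : Type*} [Field F] {V₀ V₁ : Set (Fin m → F)}
    {u : Fin m →₀ ℕ} :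
    IsLexLeading (fiberUnion V₀ V₁) (snocMonomial u 1) ↔
      IsLexLeading V₀ u ∨ IsLexLeading V₁ u := by
  rw [isLexLeading_fiberUnion_iff]
  constructor
  · rintro ⟨p, h₀, h₁, hu, hlast, hlt⟩
    have hsum : coeff u (p.eval 1) = coeff u (p.coeff 0) + coeff u (p.coeff 1) := by
      have hle : p.natDegree + 1 ≤ p.natDegree + 2 := by omega
      rw [coeff_eval_one, Finset.sum_subset (Finset.range_subset_range.2 hle),
        Finset.sum_range_succ', Finset.sum_range_succ', Finset.sum_eq_zero]
      · ring
      · exact fun i _ => hlast _ (by omega)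
      · intro i _ hi
        rw [Polynomial.coeff_eq_zero_of_natDegree_lt (by simpa using hi), coeff_zero]
    by_cases hc : coeff u (p.coeff 0) = 0
    · refine Or.inr ⟨p.eval 1, h₁, by rwa [hsum, hc, zero_add], fun u' hu' => ?_⟩
      rw [coeff_eval_one]
      exact Finset.sum_eq_zero fun i _ => hlt u' hu' i
    · refine Or.inl ⟨p.eval 0, h₀, by rwa [← Polynomial.coeff_zero_eq_eval_zero],
        fun u' hu' => ?_⟩
      rw [← Polynomial.coeff_zero_eq_eval_zero, hlt u' hu']
  · rintro (⟨f, hf, hfu, hf'⟩ | ⟨f, hf, hfu, hf'⟩)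
    · refine ⟨.C f * .X - .C f, ?_, ?_, ?_, ?_, ?_⟩
      · intro v hv
        simp [hf v hv]
      · simp
      · simpa [Polynomial.coeff_C] using hfu
      · rintro (_ | _ | i) hi
        · omega
        · omega
        · simp
      · rintro u' hu' (_ | _ | i)
        · simp [hf' u' hu']
        · simp [Polynomial.coeff_C, hf' u' hu']
        · simp
    · refine ⟨.C f * .X, ?_, ?_, ?_, ?_, ?_⟩
      · simp
      · intro v hv
        simp [hf v hv]
      · simpa using hfu
      · rintro (_ | _ | i) hi
        · omega
        · omega
        · simp
      · rintro u' hu' (_ | _ | i)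
        · simp
        · simp [hf' u' hu']
        · simp

/-- The witness is `x^u (y^j - y^{j-1})`, where `y` is the last variable. -/
theorem isLexLeading_snocMonomial_of_two_le {m : ℕ} {F : Type*} [Field F]
    {V₀ V₁ : Set (Fin m → F)} {u : Fin m →₀ ℕ} {j : ℕ} (hj : 2 ≤ j) :
    IsLexLeading (fiberUnion V₀ V₁) (snocMonomial u j) := by
  obtain ⟨j, rfl⟩ := Nat.exists_eq_add_of_le' hj
  rw [isLexLeading_fiberUnion_iff]
  refine ⟨.C (monomial u 1) * .X ^ (j + 2) - .C (monomial u 1) * .X ^ (j + 1),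
    by simp, by simp, by simp [Polynomial.coeff_X_pow], fun i hi => ?_, fun u' hu' i => ?_⟩
  · rw [Polynomial.coeff_sub, Polynomial.coeff_C_mul_X_pow, Polynomial.coeff_C_mul_X_pow,
      if_neg (by omega), if_neg (by omega)]
    simp
  · have hne : u ≠ u' := by
      rintro rfl
      exact lt_irrefl _ hu'
    rw [Polynomial.coeff_sub, Polynomial.coeff_C_mul_X_pow, Polynomial.coeff_C_mul_X_pow]
    split_ifs <;> simp [coeff_monomial, hne]

/-! ### Ballot sets -/

/-- The ballot condition `sᵢ ≥ 2 i` on `G = {s₁ < s₂ < ⋯}`, with positions and elements counted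
from `0`. -/
def IsBallot {n : ℕ} (G : Finset (Fin n)) : Prop :=
  ∀ i : Fin G.card, 2 * ((i : ℕ) + 1) ≤ (G.orderEmbOfFin rfl i : ℕ) + 1

/-- The position of `x` in `G` is the number of elements of `G` up to `x`. -/
theorem isBallot_iff_card_filter_le {n : ℕ} {G : Finset (Fin n)} :
    IsBallot G ↔ ∀ x ∈ G, 2 * (G.filter (· ≤ x)).card ≤ (x : ℕ) + 1 := by
  have hcard : ∀ i : Fin G.card,
      (G.filter (· ≤ G.orderEmbOfFin rfl i)).card = (i : ℕ) + 1 := by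
    intro i
    have : G.filter (· ≤ G.orderEmbOfFin rfl i) =
        (Finset.Iic i).map (G.orderEmbOfFin rfl).toEmbedding := by
      ext x
      simp only [Finset.mem_filter, Finset.mem_map, Finset.mem_Iic]
      constructor
      · rintro ⟨hx, hle⟩
        obtain ⟨l, rfl⟩ : x ∈ Set.range (G.orderEmbOfFin rfl) := by simpa using hx
        exact ⟨l, (G.orderEmbOfFin rfl).le_iff_le.1 hle, rfl⟩
      · rintro ⟨l, hl, rfl⟩
        exact ⟨G.orderEmbOfFin_mem rfl l, (G.orderEmbOfFin rfl).le_iff_le.2 hl⟩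
    rw [this, Finset.card_map, Fin.card_Iic]
  constructor
  · intro h x hx
    obtain ⟨i, rfl⟩ : x ∈ Set.range (G.orderEmbOfFin rfl) := by simpa using hx
    rw [hcard]
    exact h i
  · intro h i
    rw [← hcard]
    exact h _ (G.orderEmbOfFin_mem rfl i)

/-- `G ⊆ {1, …, m}` regarded as a subset of `{1, …, m + 1}`. -/
def liftFinset {m : ℕ} (G : Finset (Fin m)) : Finset (Fin (m + 1)) :=
  G.map Fin.castSuccEmb

@[simp]
theorem castSucc_mem_liftFinset {m : ℕ} {G : Finset (Fin m)} {i : Fin m} :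
    i.castSucc ∈ liftFinset G ↔ i ∈ G := by
  simp [liftFinset]

@[simp]
theorem last_notMem_liftFinset {m : ℕ} (G : Finset (Fin m)) : Fin.last m ∉ liftFinset G := by
  simp [liftFinset]

@[simp]
theorem card_liftFinset {m : ℕ} (G : Finset (Fin m)) : (liftFinset G).card = G.card :=
  Finset.card_map _

theorem card_insert_last {m : ℕ} (G : Finset (Fin m)) :
    (insert (Fin.last m) (liftFinset G)).card = G.card + 1 := by
  simp

theorem exists_eq_liftFinset_or_insert {m : ℕ} (H : Finset (Fin (m + 1))) :
    ∃ G, H = liftFinset G ∨ H = insert (Fin.last m) (liftFinset G) := by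
  refine ⟨Finset.univ.filter fun i => i.castSucc ∈ H, ?_⟩
  by_cases hl : Fin.last m ∈ H
  · right
    ext i
    refine Fin.lastCases ?_ (fun i => ?_) i <;> simp [hl, Fin.castSucc_ne_last]
  · left
    ext i
    refine Fin.lastCases ?_ (fun i => ?_) i <;> simp [hl]

theorem filter_le_liftFinset {m : ℕ} (G : Finset (Fin m)) (x : Fin m) :
    (liftFinset G).filter (· ≤ x.castSucc) = liftFinset (G.filter (· ≤ x)) := by
  ext i
  refine Fin.lastCases ?_ (fun i => ?_) i <;> simp

theorem isBallot_liftFinset {m : ℕ} {G : Finset (Fin m)} :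
    IsBallot (liftFinset G) ↔ IsBallot G := by
  simp only [isBallot_iff_card_filter_le]
  constructor
  · intro h x hx
    simpa [filter_le_liftFinset] using h x.castSucc (by simpa using hx)
  · intro h x hx
    induction x using Fin.lastCases with
    | last => exact absurd hx (last_notMem_liftFinset G)
    | cast x => simpa [filter_le_liftFinset] using h x (by simpa using hx)

theorem isBallot_insert_last {m : ℕ} {G : Finset (Fin m)} :
    IsBallot (insert (Fin.last m) (liftFinset G)) ↔ IsBallot G ∧ 2 * (G.card + 1) ≤ m + 1 := by
  have hlast : (insert (Fin.last m) (liftFinset G)).filter (· ≤ Fin.last m) =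
      insert (Fin.last m) (liftFinset G) := Finset.filter_true_of_mem fun i _ => Fin.le_last i
  have hcast : ∀ x : Fin m, (insert (Fin.last m) (liftFinset G)).filter (· ≤ x.castSucc) =
      liftFinset (G.filter (· ≤ x)) := fun x => by
    rw [Finset.filter_insert, if_neg (Fin.castSucc_lt_last x).not_ge, filter_le_liftFinset]
  simp only [isBallot_iff_card_filter_le]
  constructor
  · intro h
    refine ⟨fun x hx => ?_, ?_⟩
    · simpa [hcast] using h x.castSucc (by simp [hx])
    · simpa [hlast] using h (Fin.last m) (by simp)
  · rintro ⟨h, hm⟩ x hx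
    induction x using Fin.lastCases with
    | last => simpa [hlast] using hm
    | cast x => simpa [hcast] using h x (by simpa [Fin.castSucc_ne_last] using hx)

theorem IsBallot.two_mul_card_le {m : ℕ} {G : Finset (Fin m)} (hG : IsBallot G) :
    2 * G.card ≤ m := by
  induction m with
  | zero => simp [Finset.eq_empty_of_isEmpty G]
  | succ m ih =>
    obtain ⟨H, rfl | rfl⟩ := exists_eq_liftFinset_or_insert G
    · have := ih (isBallot_liftFinset.1 hG)
      rw [card_liftFinset]
      omega
    · rw [card_insert_last]
      exact (isBallot_insert_last.1 hG).2

@[simp]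
theorem squarefreeMonomial_apply {n : ℕ} (G : Finset (Fin n)) (i : Fin n) :
    squarefreeMonomial G i = if i ∈ G then 1 else 0 := by
  simp [squarefreeMonomial, Finsupp.finsetSum_apply, Finsupp.single_apply]

theorem squarefreeMonomial_injective {n : ℕ} :
    Function.Injective (squarefreeMonomial : Finset (Fin n) → Fin n →₀ ℕ) := by
  intro G H h
  ext i
  have := DFunLike.congr_fun h i
  simp only [squarefreeMonomial_apply] at this
  split_ifs at this <;> simp_all

theorem squarefreeMonomial_liftFinset {m : ℕ} (G : Finset (Fin m)) :
    squarefreeMonomial (liftFinset G) = snocMonomial (squarefreeMonomial G) 0 := by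
  ext i
  refine Fin.lastCases ?_ (fun i => ?_) i <;> simp

theorem squarefreeMonomial_insert_last {m : ℕ} (G : Finset (Fin m)) :
    squarefreeMonomial (insert (Fin.last m) (liftFinset G)) =
      snocMonomial (squarefreeMonomial G) 1 := by
  ext i
  refine Fin.lastCases ?_ (fun i => ?_) i <;> simp [Fin.castSucc_ne_last]

/-! ### Slices of the cube -/

/-- The `0`-`1` vectors of length `m` with coordinate sum `d`. Admitting every integer `d`, also
those for which the slice is empty, makes the recursion on `m` uniform. -/
def cubeSlice (m : ℕ) (d : ℤ) : Set (Fin m → ℚ) :=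
  {v | (∀ i, v i = 0 ∨ v i = 1) ∧ ∑ i, v i = d}

theorem cubeSlice_succ (m : ℕ) (d : ℤ) :
    cubeSlice (m + 1) d = fiberUnion (cubeSlice m d) (cubeSlice m (d - 1)) := by
  ext v
  simp only [cubeSlice, fiberUnion, Set.mem_ofPred_eq, Fin.forall_fin_succ', Fin.sum_univ_castSucc,
    Fin.init, Int.cast_sub, Int.cast_one, eq_sub_iff_add_eq]
  constructor
  · rintro ⟨⟨hv, h | h⟩, hs⟩
    · exact Or.inl ⟨h, hv, by simpa [h] using hs⟩
    · exact Or.inr ⟨h, hv, by simpa [h] using hs⟩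
  · rintro (⟨h, hv, hs⟩ | ⟨h, hv, hs⟩)
    · exact ⟨⟨hv, Or.inl h⟩, by simpa [h] using hs⟩
    · exact ⟨⟨hv, Or.inr h⟩, by simpa [h] using hs⟩

theorem linearSperner_eq_fiberUnion {m t k : ℕ} (htk : t ≤ k) {a : Fin (m + 1) → ℕ}
    (ha_init : ∀ i : Fin m, a i.castSucc = 1) (ha_last : a (Fin.last m) = t) :
    linearSperner a k = fiberUnion (cubeSlice m k) (cubeSlice m (k - t : ℕ)) := by
  ext v
  simp only [linearSperner, cubeSlice, fiberUnion, Set.mem_ofPred_eq, Fin.forall_fin_succ',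
    Fin.sum_univ_castSucc, ha_init, ha_last, Nat.cast_one, one_mul, Fin.init, Int.cast_natCast,
    Nat.cast_sub htk]
  constructor
  · rintro ⟨⟨hv, h | h⟩, hs⟩
    · exact Or.inl ⟨h, hv, by simpa [h] using hs⟩
    · exact Or.inr ⟨h, hv, by simpa [h, eq_sub_iff_add_eq] using hs⟩
  · rintro (⟨h, hv, hs⟩ | ⟨h, hv, hs⟩)
    · exact ⟨⟨hv, Or.inl h⟩, by simpa [h] using hs⟩
    · exact ⟨⟨hv, Or.inr h⟩, by simpa [h, eq_sub_iff_add_eq] using hs⟩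

theorem isLexLeading_cubeSlice_zero {d : ℤ} {w : Fin 0 →₀ ℕ} :
    IsLexLeading (cubeSlice 0 d) w ↔ d ≠ 0 := by
  constructor
  · rintro ⟨f, hf, hw, -⟩ rfl
    apply hw
    obtain ⟨c, rfl⟩ := C_surjective (R := ℚ) (Fin 0) f
    have := hf 0 ⟨by simp, by simp⟩
    simp_all
  · intro hd
    refine ⟨1, fun v hv => absurd hv.2 ?_, ?_, fun w' hw' => ?_⟩
    · rw [Finset.univ_eq_empty, Finset.sum_empty]
      exact_mod_cast hd.symm
    · simp [Subsingleton.elim w 0]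
    · exact absurd hw' (by simp [Subsingleton.elim w w'])

/-- The lex standard monomials of a slice are the ballot monomials of degree at most
`min d (m - d)`; both sides satisfy the same recursion on `m`. -/
theorem not_isLexLeading_cubeSlice_iff {m : ℕ} {d : ℤ} {w : Fin m →₀ ℕ} :
    ¬ IsLexLeading (cubeSlice m d) w ↔
      ∃ G, IsBallot G ∧ (G.card : ℤ) ≤ d ∧ (G.card : ℤ) ≤ m - d ∧ w = squarefreeMonomial G := by
  induction m generalizing d with
  | zero =>
    rw [isLexLeading_cubeSlice_zero, not_not]
    constructor
    · rintro rfl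
      exact ⟨∅, fun i => absurd i.2 (by simp), by simp, by simp, Subsingleton.elim _ _⟩
    · rintro ⟨G, -, h₁, h₂, -⟩
      push_cast at h₂
      omega
  | succ m ih =>
    obtain ⟨u, j, rfl⟩ := exists_eq_snocMonomial w
    rw [cubeSlice_succ]
    obtain rfl | rfl | hj : j = 0 ∨ j = 1 ∨ 2 ≤ j := by omega
    · rw [isLexLeading_snocMonomial_zero, not_and_or, ih, ih]
      constructor
      · rintro (⟨G, hG, h₁, h₂, rfl⟩ | ⟨G, hG, h₁, h₂, rfl⟩)
        all_goals
          refine ⟨liftFinset G, isBallot_liftFinset.2 hG, ?_, ?_,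
            (squarefreeMonomial_liftFinset G).symm⟩ <;> rw [card_liftFinset] <;> push_cast <;> omega
      · rintro ⟨H, hH, h₁, h₂, h⟩
        obtain ⟨G, rfl | rfl⟩ := exists_eq_liftFinset_or_insert H
        · rw [squarefreeMonomial_liftFinset, snocMonomial_inj] at h
          rw [isBallot_liftFinset] at hH
          rw [card_liftFinset] at h₁ h₂
          have := hH.two_mul_card_le
          push_cast at h₂
          -- The degree `|G| = d = m + 1 - d` is impossible, as `2 |G| ≤ m`.
          by_cases hd : (G.card : ℤ) ≤ m - d
          · exact Or.inl ⟨G, hH, h₁, hd, h.1⟩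
          · exact Or.inr ⟨G, hH, by omega, by omega, h.1⟩
        · rw [squarefreeMonomial_insert_last, snocMonomial_inj] at h
          omega
    · rw [isLexLeading_snocMonomial_one, not_or, ih, ih]
      constructor
      · rintro ⟨⟨G, hG, h₁, h₂, rfl⟩, ⟨G', -, h₃, h₄, h⟩⟩
        obtain rfl := squarefreeMonomial_injective h
        refine ⟨insert (Fin.last m) (liftFinset G), isBallot_insert_last.2 ⟨hG, by omega⟩, ?_, ?_,
            (squarefreeMonomial_insert_last G).symm⟩ <;> rw [card_insert_last] <;> push_cast <;>
          omega
      · rintro ⟨H, hH, h₁, h₂, h⟩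
        obtain ⟨G, rfl | rfl⟩ := exists_eq_liftFinset_or_insert H
        · rw [squarefreeMonomial_liftFinset, snocMonomial_inj] at h
          omega
        · rw [squarefreeMonomial_insert_last, snocMonomial_inj] at h
          rw [isBallot_insert_last] at hH
          rw [card_insert_last] at h₁ h₂
          push_cast at h₁ h₂
          exact ⟨⟨G, hH.1, by omega, by omega, h.1⟩, ⟨G, hH.1, by omega, by omega, h.1⟩⟩
    · refine iff_of_false (not_not.2 (isLexLeading_snocMonomial_of_two_le hj)) ?_
      rintro ⟨H, -, -, -, h⟩
      have := DFunLike.congr_fun h (Fin.last m)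
      rw [snocMonomial_last, squarefreeMonomial_apply] at this
      split_ifs at this <;> omega

theorem not_isLexLeading_cubeSlice_iff_mem_ballotMonomials {m d : ℕ} (hd : 2 * d ≤ m)
    {w : Fin m →₀ ℕ} :
    ¬ IsLexLeading (cubeSlice m d) w ↔ w ∈ ballotMonomials d m := by
  rw [not_isLexLeading_cubeSlice_iff]
  constructor
  · rintro ⟨G, hG, h₁, -, rfl⟩
    exact ⟨G, by omega, hG, rfl⟩
  · rintro ⟨G, h₁, hG, rfl⟩
    exact ⟨G, hG, by omega, by omega, rfl⟩

theorem ballotMonomials_mono {d e n : ℕ} (h : d ≤ e) :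
    ballotMonomials d n ⊆ ballotMonomials e n := by
  rintro _ ⟨G, h₁, hG, rfl⟩
  exact ⟨G, h₁.trans h, hG, rfl⟩

/-! ### The last coordinate with weight `t` -/

/-- Here `n = m + 1`, so that `k ≤ (n - 1) / 2` reads `2 * k ≤ m`, and `a = (1, …, 1, t) ∈ ℤⁿ`. -/
theorem mainTheorem5 (m t k : ℕ) (ht : 1 ≤ t) (htk : t ≤ k) (hk : 2 * k ≤ m)
    (a : Fin (m + 1) → ℕ) (ha_init : ∀ i : Fin m, a i.castSucc = 1) (ha_last : a (Fin.last m) = t) :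
    lexStandardMonomials (vanishingIdeal ℚ (linearSperner a k)) =
      {w | ∃ u ∈ ballotMonomials k m, w = liftMonomial u} ∪
      {w | ∃ u ∈ ballotMonomials (k - t) m,
        w = liftMonomial u + Finsupp.single (Fin.last m) 1} := by
  ext w
  obtain ⟨u, j, rfl⟩ := exists_eq_snocMonomial w
  rw [mem_lexStandardMonomials_vanishingIdeal, linearSperner_eq_fiberUnion htk ha_init ha_last]
  have h₀ := not_isLexLeading_cubeSlice_iff_mem_ballotMonomials hk (w := u)
  have h₁ := not_isLexLeading_cubeSlice_iff_mem_ballotMonomials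
    (show 2 * (k - t) ≤ m by omega) (w := u)
  have hmono := @ballotMonomials_mono (k - t) k m (Nat.sub_le k t) u
  simp only [Set.mem_union, Set.mem_ofPred_eq, ← snocMonomial_zero]
  have hone : ∀ u' : Fin m →₀ ℕ,
      snocMonomial u' 0 + Finsupp.single (Fin.last m) 1 = snocMonomial u' 1 := fun u' => by
    rw [snocMonomial_zero, snocMonomial]
  simp only [hone, snocMonomial_inj]
  obtain rfl | rfl | hj : j = 0 ∨ j = 1 ∨ 2 ≤ j := by omega
  · rw [isLexLeading_snocMonomial_zero, not_and_or, h₀, h₁]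
    simpa using hmono
  · rw [isLexLeading_snocMonomial_one, not_or, h₀, h₁]
    simpa using hmono
  · refine iff_of_false (not_not.2 (isLexLeading_snocMonomial_of_two_le hj)) ?_
    rintro (⟨_, _, _, h⟩ | ⟨_, _, _, h⟩) <;> omega
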